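/- Let $K$ be a field (for instance $\mathbb{C}$, or a field of rational functions in indeterminate parameters), let $r\ge 0$ and $t,u,v\in K$. For $z\in K$ with $tz\neq 1$ let $R(z)$ be the stochastic (twisted) $U_{t^{1/2}}(A_r^{(1)})$ R-matrix $$R(z)=\sum_{i=0}^r E_{ii}\otimes E_{ii}+\sum_{0\le i<j\le r}\bigl(b_+E_{ii}\otimes E_{jj}+b_-E_{jj}\otimes E_{ii}+c_+E_{ij}\otimes E_{ji}+c_-E_{ji}\otimes E_{ij}\bigr),$$ $$b_+=\frac{1-z}{1-tz},\quad b_-=\frac{t(1-z)}{1-tz},\quad c_+=\frac{1-t}{1-tz},\quad c_-=\frac{(1-t)z}{1-tz},$$ where $E_{ij}$ are the $(r+1)\times(r+1)$ matrix units, and let $\check R(z)=PR(z)$, where $P$ is the permutation matrix, $P(e_a\otimes e_b)=e_b\otimes e_a$. Let $(\phi_i,\phi_i^\dagger,k_i)$, $1\le i\le r$, be $r$ families of $t$-bosons in an associative unital $K$-algebra $A$: for every $i$, $$\phi_ik_i=tk_i\phi_i,\qquad t\phi_i^\dagger k_i=k_i\phi_i^\dagger,\qquad \phi_i\phi_i^\dagger-t\phi_i^\dagger\phi_i=1-t,\qquad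 \phi_i^\dagger\phi_i=1-k_i,$$ and elements of different families commute. For $x\in K$ let $L(x)=(L_{ij}(x))_{0\le i,j\le r}$ be the matrix over $A$ with $$L_{00}=1-ux\prod_{l=1}^rk_l,\qquad L_{0j}=\Bigl(1-uv\prod_{l=1}^rk_l\Bigr)\phi_j,\qquad L_{i0}=x\Bigl(\prod_{l=i+1}^rk_l\Bigr)\phi_i^\dagger\qquad(1\le i,j\le r),$$ and, for $1\le i,j\le r$, $$L_{ij}=\begin{cases}(x-vk_i)\prod_{l=i+1}^rk_l,& i=j,\\ x\bigl(\prod_{l=i+1}^rk_l\bigr)\phi_i^\dagger\phi_j,& i>j,\\ v\bigl(\prod_{l=i+1}^rk_l\bigr)\phi_i^\dagger\phi_j,& i<j.\end{cases}$$ Then $L$ satisfies the Yang–Baxter (RLL) algebra: for all $x,y\in K$ with $y\ne0$ and $tx\neq y$, $$\check R(x/y)\,[L(x)\otimes L(y)]=[L(y)\otimes L(x)]\,\check R(x/y),$$ where the entry of $L(x)\otimes L(y)$ in row $(i,k)$ and column $(j,l)$ is the product $L_{ij}(x)L_{kl}(y)$ in $A$. In particular this holds in the Fock representation on the space with basis $|m_1,\dots,m_r\rangle$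 ($m_i\in\mathbb{Z}_{\ge0}$), where $\phi_i|m\rangle=(1-t^{m_i})|\dots,m_i-1,\dots\rangle$, $\phi_i^\dagger|m\rangle=|\dots,m_i+1,\dots\rangle$ and $k_i|m\rangle=t^{m_i}|m\rangle$. -/

import Mathlib

open scoped Kronecker

namespace TBoson

section RMatrix

variable {K : Type*} [Field K]

/-- The weight `b₊(z) = (1 - z) / (1 - t z)`. -/
def bPlus (t z : K) : K := (1 - z) / (1 - t * z)

/-- The weight `b₋(z) = t (1 - z) / (1 - t z)`. -/
def bMinus (t z : K) : K := t * (1 - z) / (1 - t * z)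

/-- The weight `c₊(z) = (1 - t) / (1 - t z)`. -/
def cPlus (t z : K) : K := (1 - t) / (1 - t * z)

/-- The weight `c₋(z) = (1 - t) z / (1 - t z)`. -/
def cMinus (t z : K) : K := (1 - t) * z / (1 - t * z)

/-- The matrix unit `E_{i,j}`, with rows and columns labelled by `0, …, r`. -/
def E (K : Type*) [Field K] {r : ℕ} (i j : Fin (r + 1)) :
    Matrix (Fin (r + 1)) (Fin (r + 1)) K :=
  Matrix.single i j 1

/-- The stochastic (twisted) `U_{t^{1/2}}(A_r^{(1)})` R-matrix
`R(z) = ∑_i E_{ii} ⊗ E_{ii} + ∑_{i<j} (b₊ E_{ii} ⊗ E_{jj} + b₋ E_{jj} ⊗ E_{ii}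
  + c₊ E_{ij} ⊗ E_{ji} + c₋ E_{ji} ⊗ E_{ij})`. -/
def RMatrix (r : ℕ) (t z : K) :
    Matrix (Fin (r + 1) × Fin (r + 1)) (Fin (r + 1) × Fin (r + 1)) K :=
  (∑ i : Fin (r + 1), E K i i ⊗ₖ E K i i) +
    ∑ i : Fin (r + 1), ∑ j ∈ Finset.Ioi i,
      (bPlus t z • (E K i i ⊗ₖ E K j j) + bMinus t z • (E K j j ⊗ₖ E K i i) +
        cPlus t z • (E K i j ⊗ₖ E K j i) + cMinus t z • (E K j i ⊗ₖ E K i j))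

/-- The permutation matrix `P`, with `P (e_a ⊗ e_b) = e_b ⊗ e_a`. -/
def permMatrix (K : Type*) [Field K] (r : ℕ) :
    Matrix (Fin (r + 1) × Fin (r + 1)) (Fin (r + 1) × Fin (r + 1)) K :=
  Matrix.of fun a b => if a = b.swap then 1 else 0

/-- The matrix `Ř(z) = P R(z)`. -/
def RCheck (r : ℕ) (t z : K) :
    Matrix (Fin (r + 1) × Fin (r + 1)) (Fin (r + 1) × Fin (r + 1)) K :=
  permMatrix K r * RMatrix r t z

/-- The Yang–Baxter (RLL) algebra `Ř(x/y) [L(x) ⊗ L(y)] = [L(y) ⊗ L(x)] Ř(x/y)` for an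
`(r+1) × (r+1)` matrix `L(x)` with entries in a (noncommutative) `K`-algebra `A`, required at all
`x, y` where `Ř(x/y)` is defined, that is, `y ≠ 0` and `1 - t x / y ≠ 0`. The entry of
`L(x) ⊗ L(y)` in row `(i, k)` and column `(j, l)` is the product `L_{ij}(x) L_{kl}(y)`. -/
def YangBaxterAlgebra {A : Type*} [Ring A] [Algebra K A] (r : ℕ) (t : K)
    (L : K → Matrix (Fin (r + 1)) (Fin (r + 1)) A) : Prop :=
  ∀ x y : K, y ≠ 0 → 1 - t * (x / y) ≠ 0 →
    (RCheck r t (x / y)).map (algebraMap K A) * (L x ⊗ₖ L y) =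
      (L y ⊗ₖ L x) * (RCheck r t (x / y)).map (algebraMap K A)

end RMatrix

section Bosons

variable {K : Type*} [Field K] {A : Type*} [Ring A] [Algebra K A]

/-- `φ, φ†, k` are `r` mutually commuting families of `t`-bosons in the `K`-algebra `A`.
The relation `φ† φ = 1 - k` together with `φ φ† - t φ† φ = 1 - t` gives `φ φ† = 1 - t k`. -/
structure IsTBosonFamily {r : ℕ} (t : K) (φ φd k : Fin r → A) : Prop where
  phi_k : ∀ i, φ i * k i = t • (k i * φ i)
  phid_k : ∀ i, t • (φd i * k i) = k i * φd i
  phi_phid : ∀ i, φ i * φd i - t • (φd i * φ i) = algebraMap K A (1 - t)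
  phid_phi : ∀ i, φd i * φ i = 1 - k i
  comm_phi_phi : ∀ i j, i ≠ j → Commute (φ i) (φ j)
  comm_phi_phid : ∀ i j, i ≠ j → Commute (φ i) (φd j)
  comm_phi_k : ∀ i j, i ≠ j → Commute (φ i) (k j)
  comm_phid_phid : ∀ i j, i ≠ j → Commute (φd i) (φd j)
  comm_phid_k : ∀ i j, i ≠ j → Commute (φd i) (k j)
  comm_k_k : ∀ i j, i ≠ j → Commute (k i) (k j)

/-- The product `∏_{l=i+1}^{r} k_l`, for `0 ≤ i ≤ r`. The family with label `l + 1 ∈ {1, …, r}`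
is stored at index `l : Fin r`, so that its label in `{0, …, r}` is `l.succ`. -/
def kTail {r : ℕ} (k : Fin r → A) (i : Fin (r + 1)) : A :=
  (((List.finRange r).filter fun l => i < l.succ).map k).prod

/-- The rank-`r` L-matrix. The cases of the pattern match are `L_{00}`, `L_{0j}`, `L_{i0}` and
`L_{ij}` for `1 ≤ i, j ≤ r`. -/
def LMatrix {r : ℕ} (u v : K) (φ φd k : Fin r → A) (x : K) :
    Matrix (Fin (r + 1)) (Fin (r + 1)) A :=
  Matrix.of fun a b =>
    Fin.cases
      (Fin.cases
        (1 - (u * x) • kTail k 0)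
        (fun j => (1 - (u * v) • kTail k 0) * φ j) b)
      (fun i => Fin.cases
        (x • (kTail k i.succ * φd i))
        (fun j =>
          if i = j then (algebraMap K A x - v • k i) * kTail k i.succ
          else if j < i then x • (kTail k i.succ * φd i * φ j)
          else v • (kTail k i.succ * φd i * φ j)) b) a

end Bosons

section Fock

variable {K : Type*} [Field K]

/-- The Fock space `F₁ ⊗ ⋯ ⊗ F_r`: the vector space with basis the kets `|m₁, …, m_r⟩`. -/
abbrev FockSpace (K : Type*) [Field K] (r : ℕ) : Type _ := (Fin r → ℕ) →₀ K

/-- The ket `|m₁, …, m_r⟩`. -/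
noncomputable def ket (K : Type*) [Field K] {r : ℕ} (m : Fin r → ℕ) : FockSpace K r := Finsupp.single m 1

/-- `φ_i |m⟩ = (1 - t^{m_i}) |…, m_i - 1, …⟩` (which is `0` if `m_i = 0`). -/
noncomputable def fockPhi {r : ℕ} (t : K) (i : Fin r) : Module.End K (FockSpace K r) :=
  Finsupp.linearCombination K fun m : Fin r → ℕ =>
    (1 - t ^ m i) • ket K (Function.update m i (m i - 1))

/-- `φ†_i |m⟩ = |…, m_i + 1, …⟩`. -/
noncomputable def fockPhiDag (K : Type*) [Field K] {r : ℕ} (i : Fin r) :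
    Module.End K (FockSpace K r) :=
  Finsupp.linearCombination K fun m : Fin r → ℕ => ket K (Function.update m i (m i + 1))

/-- `k_i |m⟩ = t^{m_i} |m⟩`. -/
noncomputable def fockK {r : ℕ} (t : K) (i : Fin r) : Module.End K (FockSpace K r) :=
  Finsupp.linearCombination K fun m : Fin r → ℕ => (t ^ m i) • ket K m

end Fock

end TBoson

/-!
The L-matrix is affine in the spectral parameter, `L(x) = x A + B`, with `A` lower triangular and
`B` upper triangular, and `(1 - t z) Ř(z) = (1 - t) z + (1 - z) S` for a constant matrix `S`, the
Hecke form of the R-matrix. Comparing coefficients of `x` and `y`, the RLL relation follows from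
four relations without spectral parameter:
`S (A ⊗ A) = (A ⊗ A) S`, `S (B ⊗ B) = (B ⊗ B) S`, `S (B ⊗ A) = (A ⊗ B) S` and
`(1 - t) A ⊗ B - S (A ⊗ B) = (1 - t) B ⊗ A - (B ⊗ A) S`.
When `t ≠ 0` the last two are equivalent, `S` being invertible by the Hecke relation; since `t = 0`
is allowed, both are checked. This reduction is `yangBaxterAlgebra_of_quadratic`; entrywise, the
four relations follow from the quadratic exchange relations collected in `IsQuadratic` and
`IsMixedQuadratic`.

The entries of `A` and `B` are built from three sequences indexed by `0, …, r`: the annihilators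
`f = (1, φ_1, …, φ_r)`, the dressed creators `p_i = k_{i+1} ⋯ k_r φ†_i`, and the tails
`Q_i = k_{i+1} ⋯ k_r`, with `Q_0 = -u k_1 ⋯ k_r`. For `i ≥ 1` the factor `k_i` enters only through
`p_i f_i = (1 - k_i) Q_i`, so `k_i Q_i` can be eliminated, and what remains is a system of rewriting
rules that brings every monomial to the normal order `p ⋯ Q ⋯ f ⋯` (`IsOrderedFamily`). The rules
depend only on the relative position of indices, so each exchange relation is verified by running
through the possible interleavings of its row and column indices and comparing normal forms.
-/

namespace TBoson

/-! ### The Hecke form of the R-matrix -/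

section Hecke

variable {K : Type*} [Field K]

/-- The constant matrix `S` with `(1 - t z) Ř(z) = (1 - t) z + (1 - z) S`, that is `S = Ř(0)`.
The first summand holds its diagonal entries, the second the entries at `(i, j), (j, i)`. -/
def heckeMatrix (r : ℕ) (t : K) :
    Matrix (Fin (r + 1) × Fin (r + 1)) (Fin (r + 1) × Fin (r + 1)) K :=
  Matrix.of fun p q =>
    (if p = q then (if p.1 < p.2 then 0 else if p.1 = p.2 then 1 else 1 - t) else 0) +
      if p.1 ≠ p.2 ∧ p = q.swap then (if p.1 < p.2 then t else 1) else 0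

theorem RMatrix_apply (r : ℕ) (t z : K) (a b c d : Fin (r + 1)) :
    RMatrix r t z (a, b) (c, d) =
      if a = b then (if c = a ∧ d = b then 1 else 0)
      else if a < b then
        (if c = a ∧ d = b then bPlus t z else if c = b ∧ d = a then cPlus t z else 0)
      else (if c = a ∧ d = b then bMinus t z else if c = b ∧ d = a then cMinus t z else 0) := by
  have h : ∀ i : Fin (r + 1), Finset.Ioi i = Finset.univ.filter (i < ·) := by
    intro i; ext j; simp
  have h2 : ∀ (g : Fin (r+1) → Fin (r+1) → K) (e e' : Fin (r + 1)),
      (∑ i, ∑ j, if i = e ∧ j = e' then g i j else 0) = g e e' := by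
    intro g e e'
    simp [ite_and]
  have h3 : RMatrix r t z (a, b) (c, d) =
      (∑ i, if i = a then (if c = a ∧ b = a ∧ d = a then (1 : K) else 0) else 0) +
      ((∑ i, ∑ j, if i = a ∧ j = b then
          (if i < j ∧ c = a ∧ d = b then bPlus t z else 0) else 0) +
       (∑ i, ∑ j, if i = b ∧ j = a then
          (if i < j ∧ c = a ∧ d = b then bMinus t z else 0) else 0) +
       (∑ i, ∑ j, if i = a ∧ j = b then
          (if i < j ∧ c = b ∧ d = a then cPlus t z else 0) else 0) +
       (∑ i, ∑ j, if i = b ∧ j = a then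
          (if i < j ∧ c = b ∧ d = a then cMinus t z else 0) else 0)) := by
    -- For given `a`, `b`, each matrix unit fixes the summation indices `i`, `j`.
    simp only [RMatrix, E, Matrix.add_apply, Matrix.sum_apply,
      Matrix.kronecker_apply, Matrix.single_apply, h, Finset.sum_filter]
    congr 1
    · refine Finset.sum_congr rfl fun i _ => ?_
      grind
    · simp only [← Finset.sum_add_distrib]
      refine Finset.sum_congr rfl fun i _ => Finset.sum_congr rfl fun j _ => ?_
      by_cases hij : i < j
      · simp only [hij, if_true, true_and, smul_eq_mul, Matrix.add_apply, Matrix.smul_apply,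
          Matrix.kronecker_apply, Matrix.single_apply]
        grind
      · simp [hij]
  rw [h3, h2, h2, h2, h2]
  rcases lt_trichotomy a b with hab | rfl | hab
  · simp only [Finset.sum_ite_eq', Finset.mem_univ, if_true, hab, hab.ne, hab.ne', hab.not_gt]
    grind
  · simp
  · simp only [Finset.sum_ite_eq', Finset.mem_univ, if_true, hab, hab.ne, hab.ne', hab.not_gt]
    grind

theorem RCheck_apply (r : ℕ) (t z : K) (p q : Fin (r + 1) × Fin (r + 1)) :
    RCheck r t z p q = RMatrix r t z p.swap q := by
  have h : ∀ s : Fin (r + 1) × Fin (r + 1), p = s.swap ↔ s = p.swap := by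
    intro s; constructor <;> rintro rfl <;> simp
  simp [RCheck, permMatrix, Matrix.mul_apply, h]

theorem smul_RCheck (r : ℕ) (t z : K) (h : 1 - t * z ≠ 0) :
    (1 - t * z) • RCheck r t z = ((1 - t) * z) • 1 + (1 - z) • heckeMatrix r t := by
  ext ⟨a, b⟩ ⟨c, d⟩
  simp only [Matrix.smul_apply, Matrix.add_apply, RCheck_apply, Prod.swap, RMatrix_apply,
    heckeMatrix, Matrix.of_apply, Matrix.one_apply, Prod.mk.injEq, smul_eq_mul,
    bPlus, bMinus, cPlus, cMinus]
  rcases lt_trichotomy a b with hab | rfl | hab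
  · simp only [hab, hab.ne, hab.ne', hab.not_gt, if_true, if_false, ne_eq, not_false_eq_true,
      true_and]
    by_cases h1 : c = a ∧ d = b
    · obtain ⟨rfl, rfl⟩ := h1
      simp [hab.ne, hab.ne']
      field_simp
    · by_cases h2 : c = b ∧ d = a
      · obtain ⟨rfl, rfl⟩ := h2
        simp [hab.ne, hab.ne']
        field_simp
      · grind
  · by_cases h1 : c = a ∧ d = a
    · obtain ⟨rfl, rfl⟩ := h1
      simp
      ring
    · grind
  · simp only [hab, hab.ne, hab.ne', hab.not_gt, if_true, if_false, ne_eq, not_false_eq_true,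
      true_and]
    by_cases h1 : c = a ∧ d = b
    · obtain ⟨rfl, rfl⟩ := h1
      simp [hab.ne, hab.ne']
      field_simp
      ring
    · by_cases h2 : c = b ∧ d = a
      · obtain ⟨rfl, rfl⟩ := h2
        simp [hab.ne, hab.ne']
        field_simp
      · grind

variable {A : Type*} [Ring A] [Algebra K A] {r : ℕ}

theorem hecke_mul_kronecker (t : K) (M N : Matrix (Fin (r + 1)) (Fin (r + 1)) A)
    (a b c d : Fin (r + 1)) :
    ((heckeMatrix r t).map (algebraMap K A) * (M ⊗ₖ N)) (a, b) (c, d) =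
      if a < b then t • (M b c * N a d)
      else if a = b then M a c * N a d
      else (1 - t) • (M a c * N b d) + M b c * N a d := by
  have h : ∀ s : Fin (r + 1) × Fin (r + 1), (a, b) = s.swap ↔ s = (b, a) := by
    intro s; constructor <;> intro h <;> simp_all [Prod.ext_iff]
  rcases lt_trichotomy a b with hab | rfl | hab
  · simp [Matrix.mul_apply, heckeMatrix, h, hab, hab.ne, Algebra.smul_def,
      apply_ite (algebraMap K A)]
  · simp [Matrix.mul_apply, heckeMatrix, apply_ite (algebraMap K A)]
  · simp [Matrix.mul_apply, heckeMatrix, h, hab.ne', hab.not_gt, Algebra.smul_def,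
      apply_ite (algebraMap K A), add_mul, Finset.sum_add_distrib,
      -map_sub]

theorem kronecker_mul_hecke (t : K) (M N : Matrix (Fin (r + 1)) (Fin (r + 1)) A)
    (a b c d : Fin (r + 1)) :
    ((M ⊗ₖ N) * (heckeMatrix r t).map (algebraMap K A)) (a, b) (c, d) =
      if c < d then M a d * N b c
      else if c = d then M a c * N b c
      else (1 - t) • (M a c * N b d) + t • (M a d * N b c) := by
  have h : ∀ s : Fin (r + 1) × Fin (r + 1), heckeMatrix r t s (c, d) =
      (if s = (c, d) then (if c < d then 0 else if c = d then 1 else 1 - t) else 0) +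
        if s = (d, c) then (if c = d then 0 else if d < c then t else 1) else 0 := by
    rintro ⟨a, b⟩
    simp only [heckeMatrix, Matrix.of_apply, Prod.swap_prod_mk, Prod.mk.injEq]
    grind
  rcases lt_trichotomy c d with hab | rfl | hab
  · simp [Matrix.mul_apply, h, hab, hab.ne, hab.not_gt, apply_ite (algebraMap K A)]
  · simp [Matrix.mul_apply, h, apply_ite (algebraMap K A)]
  · simp [Matrix.mul_apply, h, hab, hab.ne', hab.not_gt, Algebra.smul_def, Algebra.commutes,
      apply_ite (algebraMap K A), mul_add, Finset.sum_add_distrib, -map_sub]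

end Hecke
/-! ### From exchange relations to the Yang-Baxter algebra -/

section Quadratic

variable {K : Type*} [Field K] {A : Type*} [Ring A] [Algebra K A] {r : ℕ}

/-- The entrywise form of `S (M ⊗ M) = (M ⊗ M) S`: exchange relations within a row, within a
column, and between the antidiagonal or diagonal corners of each `2 × 2` minor. -/
structure IsQuadratic (t : K) (M : Matrix (Fin (r + 1)) (Fin (r + 1)) A) : Prop where
  row : ∀ a c d, c < d → M a c * M a d = M a d * M a c
  col : ∀ a b c, a < b → M a c * M b c = t • (M b c * M a c)
  anti : ∀ a b c d, a < b → c < d → M a d * M b c = t • (M b c * M a d)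
  diag : ∀ a b c d, a < b → c < d →
    M b d * M a c = M a c * M b d + (1 - t) • (M b c * M a d)

theorem IsQuadratic.hecke_comm {t : K} {M : Matrix (Fin (r + 1)) (Fin (r + 1)) A}
    (h : IsQuadratic t M) :
    (heckeMatrix r t).map (algebraMap K A) * (M ⊗ₖ M) =
      (M ⊗ₖ M) * (heckeMatrix r t).map (algebraMap K A) := by
  ext ⟨a, b⟩ ⟨c, d⟩
  rw [hecke_mul_kronecker, kronecker_mul_hecke]
  rcases lt_trichotomy a b with hab | rfl | hab <;>
    rcases lt_trichotomy c d with hcd | rfl | hcd <;>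
    simp only [*, lt_irrefl, if_true, if_false, LT.lt.ne, LT.lt.ne', LT.lt.not_gt]
  · rw [h.anti a b c d hab hcd]
  · rw [h.col a b c hab]
  · rw [h.diag a b d c hab hcd, h.anti a b d c hab hcd]
    module
  · rw [h.row a c d hcd]
  · rw [h.row a d c hcd]
    module
  · rw [h.diag b a c d hab hcd]
    module
  · rw [h.col b a c hab]
    module
  · rw [h.diag b a d c hab hcd, h.anti b a d c hab hcd]

/-- Exchange relations between the entries of `M` and those of `N`, in the form they take for a
lower triangular `M` and an upper triangular `N`. The products in the fields ending in `zero`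
and `zero'` vanish because one of the two factors lies outside its triangle. Together the fields
imply both mixed relations between `M ⊗ N` and `N ⊗ M`. -/
structure IsMixedQuadratic (t : K) (M N : Matrix (Fin (r + 1)) (Fin (r + 1)) A) : Prop where
  entry : ∀ a c, M a c * N a c = N a c * M a c
  row_zero : ∀ a c d, c < d → M a d * N a c = 0
  row_zero' : ∀ a c d, c < d → N a c * M a d = 0
  row : ∀ a c d, c < d → N a d * M a c = t • (M a c * N a d)
  col_zero : ∀ a b c, a < b → M a c * N b c = 0
  col_zero' : ∀ a b c, a < b → N b c * M a c = 0
  col : ∀ a b c, a < b → N a c * M b c = M b c * N a c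
  anti_zero : ∀ a b c d, a < b → c < d → M a d * N b c = 0
  anti_zero' : ∀ a b c d, a < b → c < d → N b c * M a d = 0
  diag : ∀ a b c d, a < b → c < d → N b d * M a c = M a c * N b d
  diag' : ∀ a b c d, a < b → c < d → N a c * M b d = M b d * N a c
  anti : ∀ a b c d, a < b → c < d →
    N a d * M b c = t • (M b c * N a d) + (1 - t) • (M b d * N a c - M a c * N b d)

theorem IsMixedQuadratic.hecke_comm {t : K} {M N : Matrix (Fin (r + 1)) (Fin (r + 1)) A}
    (h : IsMixedQuadratic t M N) :
    (heckeMatrix r t).map (algebraMap K A) * (N ⊗ₖ M) =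
      (M ⊗ₖ N) * (heckeMatrix r t).map (algebraMap K A) := by
  ext ⟨a, b⟩ ⟨c, d⟩
  rw [hecke_mul_kronecker, kronecker_mul_hecke]
  rcases lt_trichotomy a b with hab | rfl | hab <;>
    rcases lt_trichotomy c d with hcd | rfl | hcd <;>
    simp only [*, lt_irrefl, if_true, if_false, LT.lt.ne, LT.lt.ne', LT.lt.not_gt]
  · rw [h.anti_zero a b c d hab hcd, h.anti_zero' a b c d hab hcd, smul_zero]
  · rw [h.col_zero a b c hab, h.col_zero' a b c hab, smul_zero]
  · rw [h.anti_zero a b d c hab hcd, h.diag a b d c hab hcd]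
    module
  · rw [h.row_zero a c d hcd, h.row_zero' a c d hcd]
  · exact (h.entry a c).symm
  · rw [h.row_zero a d c hcd, h.row a d c hcd]
    module
  · rw [h.anti_zero' b a c d hab hcd, h.diag' b a c d hab hcd]
    module
  · rw [h.col_zero' b a c hab, h.col b a c hab]
    module
  · rw [h.diag b a d c hab hcd, h.anti b a d c hab hcd]
    module

theorem IsMixedQuadratic.hecke_comm_sub {t : K}
    {M N : Matrix (Fin (r + 1)) (Fin (r + 1)) A} (h : IsMixedQuadratic t M N) :
    (1 - t) • (M ⊗ₖ N) - (heckeMatrix r t).map (algebraMap K A) * (M ⊗ₖ N) =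
      (1 - t) • (N ⊗ₖ M) - (N ⊗ₖ M) * (heckeMatrix r t).map (algebraMap K A) := by
  ext ⟨a, b⟩ ⟨c, d⟩
  rw [Matrix.sub_apply, Matrix.sub_apply, hecke_mul_kronecker, kronecker_mul_hecke]
  simp only [Matrix.smul_apply, Matrix.kronecker_apply]
  rcases lt_trichotomy a b with hab | rfl | hab <;>
    rcases lt_trichotomy c d with hcd | rfl | hcd <;>
    simp only [*, lt_irrefl, if_true, if_false, LT.lt.ne, LT.lt.ne', LT.lt.not_gt]
  · rw [h.anti a b c d hab hcd, h.diag' a b c d hab hcd]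
    module
  · rw [h.col_zero a b c hab, h.col a b c hab]
    module
  · rw [h.anti_zero a b d c hab hcd, h.diag' a b d c hab hcd]
    module
  · rw [h.row_zero' a c d hcd, h.row a c d hcd]
    module
  · rw [h.entry a c]
  · rw [h.row_zero a d c hcd, h.row_zero' a d c hcd]
    module
  · rw [h.anti_zero' b a c d hab hcd, h.diag b a c d hab hcd]
    module
  · rw [h.col_zero b a c hab, h.col_zero' b a c hab]
    module
  · rw [h.anti_zero b a d c hab hcd, h.anti_zero' b a d c hab hcd]
    module

/-- The RLL relation for `x M + N`: with `z = x / y`, the difference of its two sides, multiplied by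
`1 - t z`, is a combination of the four relations without spectral parameter. -/
theorem yangBaxterAlgebra_of_quadratic {t : K} {M N : Matrix (Fin (r + 1)) (Fin (r + 1)) A}
    (hM : IsQuadratic t M) (hN : IsQuadratic t N) (h : IsMixedQuadratic t M N) :
    YangBaxterAlgebra r t fun x => x • M + N := by
  intro x y hy hxy
  set z := x / y with hz
  have hx : x = y * z := by rw [hz]; field_simp
  clear_value z
  subst hx
  set S := (heckeMatrix r t).map (algebraMap K A) with hS
  have hR : (1 - t * z) • (RCheck r t z).map (algebraMap K A) =
      ((1 - t) * z) • 1 + (1 - z) • S := by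
    have := congrArg (fun X => X.map (algebraMap K A)) (smul_RCheck r t z hxy)
    have e1 : ∀ (c : K) (X : Matrix (Fin (r + 1) × Fin (r + 1)) (Fin (r + 1) × Fin (r + 1)) K),
        (c • X).map (algebraMap K A) = c • X.map (algebraMap K A) := by
      intro c X
      ext i j
      rw [Matrix.map_apply, Matrix.smul_apply, Matrix.smul_apply, smul_eq_mul, map_mul,
        Matrix.map_apply, Algebra.smul_def]
    simpa [Matrix.map_add, e1] using this
  have h1 := hM.hecke_comm
  have h2 := hN.hecke_comm
  have h3 := h.hecke_comm
  have h4 := h.hecke_comm_sub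
  rw [← hS] at h1 h2 h3 h4
  have key : ((1 - t * z) • (RCheck r t z).map (algebraMap K A)) *
        (((y * z) • M + N) ⊗ₖ (y • M + N)) =
      ((y • M + N) ⊗ₖ ((y * z) • M + N)) *
        ((1 - t * z) • (RCheck r t z).map (algebraMap K A)) := by
    rw [hR]
    simp only [Matrix.add_kronecker, Matrix.kronecker_add, Matrix.smul_kronecker,
      Matrix.kronecker_smul, add_mul, mul_add, smul_mul_assoc, mul_smul_comm, one_mul, mul_one]
    linear_combination (norm := module) ((1 - z) * y * y * z) • h1 + (1 - z) • h2 +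
      ((1 - z) * y) • h3 - ((1 - z) * y * z) • h4
  rw [smul_mul_assoc, mul_smul_comm] at key
  exact smul_right_injective _ hxy key

end Quadratic
/-! ### Triangular parts and normal ordering -/

section Triangular

variable {K : Type*} [Field K] {A : Type*} [Ring A] [Algebra K A] {r : ℕ}

/-- Rewriting rules that put every monomial in `f`, `p`, `Q` in the order `p ⋯ Q ⋯ f ⋯`. For bosons,
`f = (1, φ_1, …, φ_r)`, `p_i = k_{i+1} ⋯ k_r φ†_i` and `Q_i` is a multiple of `k_{i+1} ⋯ k_r`. The
exchange rule `f_p_self` is the only one that is not a `t`-commutation; it excludes the index `0`, where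
there is no boson. -/
structure IsOrderedFamily (t : K) (f p Q : Fin (r + 1) → A) : Prop where
  f_zero : f 0 = 1
  f_f : ∀ i j, f i * f j = f j * f i
  p_p : ∀ i j, i < j → p i * p j = t • (p j * p i)
  Q_Q : ∀ i j, Q i * Q j = Q j * Q i
  f_p_lt : ∀ i j, i < j → f i * p j = p j * f i
  f_p_gt : ∀ i j, i < j → f j * p i = t • (p i * f j)
  f_p_self : ∀ i, 0 < i → f i * p i = (1 - t) • Q i + t • (p i * f i)
  f_Q_self : ∀ i, f i * Q i = Q i * f i
  f_Q_lt : ∀ i j, i < j → f i * Q j = Q j * f i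
  f_Q_gt : ∀ i j, i < j → f j * Q i = t • (Q i * f j)
  Q_p_self : ∀ i, Q i * p i = p i * Q i
  Q_p_gt : ∀ i j, i < j → Q j * p i = p i * Q j
  Q_p_lt : ∀ i j, i < j → Q i * p j = t • (p j * Q i)

/-- The coefficient of `x` in the L-matrix. -/
def lowerPart (f p Q : Fin (r + 1) → A) : Matrix (Fin (r + 1)) (Fin (r + 1)) A :=
  Matrix.of fun i j => if j < i then p i * f j else if i = j then Q i else 0

/-- The constant term of the L-matrix. Its row `0` has `1 + v Q_0` in place of the factor `v p_i` of
the other rows. For `i ≥ 1` the diagonal entry `v (p_i f_i - Q_i)` equals `-v k_i Q_i`. -/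
def upperPart (v : K) (f p Q : Fin (r + 1) → A) : Matrix (Fin (r + 1)) (Fin (r + 1)) A :=
  Matrix.of fun i j =>
    if i < j then (if i = 0 then (1 + v • Q 0) * f j else v • (p i * f j))
    else if i = j then (if i = 0 then 1 else v • (p i * f i - Q i)) else 0

namespace IsOrderedFamily

variable {t v : K} {f p Q : Fin (r + 1) → A} (h : IsOrderedFamily t f p Q)
include h

/-- The rewriting rules with a further factor `z` on the right, so that together with the rules
themselves they apply anywhere in a right-associated product. -/
theorem normalOrder :
    ((∀ i j, ∀ z : A, f i * (f j * z) = f j * (f i * z)) ∧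
      (∀ i j, ∀ z : A, Q i * (Q j * z) = Q j * (Q i * z))) ∧
    (∀ i j, i < j → ∀ z : A, p i * (p j * z) = t • (p j * (p i * z))) ∧
    ((∀ i j, i < j → ∀ z : A, f i * (p j * z) = p j * (f i * z)) ∧
      (∀ i j, i < j → ∀ z : A, f j * (p i * z) = t • (p i * (f j * z))) ∧
      (∀ i, 0 < i → ∀ z : A, f i * (p i * z) = (1 - t) • (Q i * z) + t • (p i * (f i * z)))) ∧
    ((∀ i, ∀ z : A, f i * (Q i * z) = Q i * (f i * z)) ∧
      (∀ i j, i < j → ∀ z : A, f i * (Q j * z) = Q j * (f i * z)) ∧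
      (∀ i j, i < j → ∀ z : A, f j * (Q i * z) = t • (Q i * (f j * z)))) ∧
    (∀ i, ∀ z : A, Q i * (p i * z) = p i * (Q i * z)) ∧
    (∀ i j, i < j → ∀ z : A, Q j * (p i * z) = p i * (Q j * z)) ∧
    (∀ i j, i < j → ∀ z : A, Q i * (p j * z) = t • (p j * (Q i * z))) := by
  refine ⟨⟨fun i j z => ?_, fun i j z => ?_⟩, fun i j hij z => ?_,
    ⟨fun i j hij z => ?_, fun i j hij z => ?_, fun i hi z => ?_⟩,
    ⟨fun i z => ?_, fun i j hij z => ?_, fun i j hij z => ?_⟩,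
    fun i z => ?_, fun i j hij z => ?_, fun i j hij z => ?_⟩ <;> rw [← mul_assoc]
  · rw [h.f_f, mul_assoc]
  · rw [h.Q_Q, mul_assoc]
  · rw [h.p_p i j hij, smul_mul_assoc, mul_assoc]
  · rw [h.f_p_lt i j hij, mul_assoc]
  · rw [h.f_p_gt i j hij, smul_mul_assoc, mul_assoc]
  · rw [h.f_p_self i hi, add_mul, smul_mul_assoc, smul_mul_assoc, mul_assoc]
  · rw [h.f_Q_self, mul_assoc]
  · rw [h.f_Q_lt i j hij, mul_assoc]
  · rw [h.f_Q_gt i j hij, smul_mul_assoc, mul_assoc]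
  · rw [h.Q_p_self, mul_assoc]
  · rw [h.Q_p_gt i j hij, mul_assoc]
  · rw [h.Q_p_lt i j hij, smul_mul_assoc, mul_assoc]

set_option linter.unusedSimpArgs false in
set_option maxHeartbeats 2000000 in
theorem isQuadratic_lowerPart : IsQuadratic t (lowerPart f p Q) := by
  have pos : ∀ i j : Fin (r + 1), i < j → 0 < j := fun i j hij => i.zero_le.trans_lt hij
  -- The simplifier normal-orders using the hypotheses in the context: the rules of `h`, `hz`, and
  -- the comparisons between indices, which decide which rule applies.
  have hz := h.normalOrder
  obtain ⟨-, h1, h2, h3, h4, h5, h6, h7, h8, h9, h10, h11, h12⟩ := h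
  constructor
  · intro a c d hcd
    have := pos c d hcd
    rcases lt_trichotomy a c with hac | hac | hac <;>
    rcases lt_trichotomy a d with had | had | had
    all_goals first
    | (exfalso; order)
    | (subst_vars
       simp only [lowerPart, Matrix.of_apply, *, lt_irrefl, if_true, if_false, LT.lt.ne,
         LT.lt.ne', LT.lt.not_gt, mul_assoc, smul_mul_assoc, mul_smul_comm, mul_zero, zero_mul,
         mul_add, add_mul, mul_sub, sub_mul, smul_add, smul_sub, smul_smul, smul_zero, mul_one,
         one_mul]
       try module)
  · intro a b c hab
    have := pos a b hab
    rcases lt_trichotomy a c with hac | hac | hac <;>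
    rcases lt_trichotomy b c with hbc | hbc | hbc
    all_goals first
    | (exfalso; order)
    | (subst_vars
       simp only [lowerPart, Matrix.of_apply, *, lt_irrefl, if_true, if_false, LT.lt.ne,
         LT.lt.ne', LT.lt.not_gt, mul_assoc, smul_mul_assoc, mul_smul_comm, mul_zero, zero_mul,
         mul_add, add_mul, mul_sub, sub_mul, smul_add, smul_sub, smul_smul, smul_zero, mul_one,
         one_mul]
       try module)
  all_goals
    intro a b c d hab hcd
    have := pos a b hab
    have := pos c d hcd
    clear pos
    rcases lt_trichotomy a c with hac | hac | hac <;>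
    rcases lt_trichotomy a d with had | had | had <;> try (exfalso; order)
    all_goals rcases lt_trichotomy b c with hbc | hbc | hbc <;> try (exfalso; order)
    all_goals rcases lt_trichotomy b d with hbd | hbd | hbd <;> first
    | (exfalso; order)
    | (subst_vars
       simp only [lowerPart, Matrix.of_apply, *, lt_irrefl, if_true, if_false, LT.lt.ne,
         LT.lt.ne', LT.lt.not_gt, mul_assoc, smul_mul_assoc, mul_smul_comm, mul_zero, zero_mul,
         mul_add, add_mul, mul_sub, sub_mul, smul_add, smul_sub, smul_smul, smul_zero, mul_one,
         one_mul]
       try module)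

set_option linter.unusedSimpArgs false in
set_option maxHeartbeats 2000000 in
theorem isQuadratic_upperPart (v : K) : IsQuadratic t (upperPart v f p Q) := by
  have pos : ∀ i j : Fin (r + 1), i < j → 0 < j := fun i j hij => i.zero_le.trans_lt hij
  have hz := h.normalOrder
  obtain ⟨h0, h1, h2, h3, h4, h5, h6, h7, h8, h9, h10, h11, h12⟩ := h
  constructor
  · intro a c d hcd
    have := pos c d hcd
    rcases lt_trichotomy a c with hac | hac | hac <;>
    rcases lt_trichotomy a d with had | had | had
    all_goals first
    | (exfalso; order)
    -- Row `0` has entries of a different shape, and only the smaller row index can be `0`.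
    | (rcases a.zero_le.eq_or_lt with ha | ha <;> subst_vars <;> first
       | exact absurd ‹_ < (0 : Fin (r + 1))› (Fin.not_lt_zero _)
       | (simp only [upperPart, Matrix.of_apply, *, lt_irrefl, if_true, if_false,
            LT.lt.ne, LT.lt.ne', LT.lt.not_gt, mul_assoc, smul_mul_assoc, mul_smul_comm,
            mul_zero, zero_mul, mul_add, add_mul, mul_sub, sub_mul, smul_add, smul_sub,
            smul_smul, smul_zero, mul_one, one_mul]
          try module))
  · intro a b c hab
    have := pos a b hab
    rcases lt_trichotomy a c with hac | hac | hac <;>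
    rcases lt_trichotomy b c with hbc | hbc | hbc
    all_goals first
    | (exfalso; order)
    | (rcases a.zero_le.eq_or_lt with ha | ha <;> subst_vars <;> first
       | exact absurd ‹_ < (0 : Fin (r + 1))› (Fin.not_lt_zero _)
       | (simp only [upperPart, Matrix.of_apply, *, lt_irrefl, if_true, if_false,
            LT.lt.ne, LT.lt.ne', LT.lt.not_gt, mul_assoc, smul_mul_assoc, mul_smul_comm,
            mul_zero, zero_mul, mul_add, add_mul, mul_sub, sub_mul, smul_add, smul_sub,
            smul_smul, smul_zero, mul_one, one_mul]
          try module))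
  all_goals
    intro a b c d hab hcd
    have := pos a b hab
    have := pos c d hcd
    clear pos
    rcases lt_trichotomy a c with hac | hac | hac <;>
    rcases lt_trichotomy a d with had | had | had <;> try (exfalso; order)
    all_goals rcases lt_trichotomy b c with hbc | hbc | hbc <;> try (exfalso; order)
    all_goals rcases lt_trichotomy b d with hbd | hbd | hbd <;> first
    | (exfalso; order)
    | (rcases a.zero_le.eq_or_lt with ha | ha <;> subst_vars <;> first
       | exact absurd ‹_ < (0 : Fin (r + 1))› (Fin.not_lt_zero _)
       | (simp only [upperPart, Matrix.of_apply, *, lt_irrefl, if_true, if_false,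
            LT.lt.ne, LT.lt.ne', LT.lt.not_gt, mul_assoc, smul_mul_assoc, mul_smul_comm,
            mul_zero, zero_mul, mul_add, add_mul, mul_sub, sub_mul, smul_add, smul_sub,
            smul_smul, smul_zero, mul_one, one_mul]
          try module))

set_option linter.unusedSimpArgs false in
set_option maxHeartbeats 2000000 in
theorem isMixedQuadratic (v : K) :
    IsMixedQuadratic t (lowerPart f p Q) (upperPart v f p Q) := by
  have pos : ∀ i j : Fin (r + 1), i < j → 0 < j := fun i j hij => i.zero_le.trans_lt hij
  have hz := h.normalOrder
  obtain ⟨h0, h1, h2, h3, h4, h5, h6, h7, h8, h9, h10, h11, h12⟩ := h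
  constructor
  case entry =>
    intro a c
    rcases lt_trichotomy a c with hac | hac | hac
    all_goals first
    | (exfalso; order)
    | (rcases a.zero_le.eq_or_lt with ha | ha <;> subst_vars <;> first
       | exact absurd ‹_ < (0 : Fin (r + 1))› (Fin.not_lt_zero _)
       | (simp only [lowerPart, upperPart, Matrix.of_apply, *, lt_irrefl, if_true, if_false,
            LT.lt.ne, LT.lt.ne', LT.lt.not_gt, mul_assoc, smul_mul_assoc, mul_smul_comm,
            mul_zero, zero_mul, mul_add, add_mul, mul_sub, sub_mul, smul_add, smul_sub,
            smul_smul, smul_zero, mul_one, one_mul]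
          try module))
  case row_zero | row_zero' | row =>
    intro a c d hcd
    have := pos c d hcd
    rcases lt_trichotomy a c with hac | hac | hac <;>
    rcases lt_trichotomy a d with had | had | had
    all_goals first
    | (exfalso; order)
    | (rcases a.zero_le.eq_or_lt with ha | ha <;> subst_vars <;> first
       | exact absurd ‹_ < (0 : Fin (r + 1))› (Fin.not_lt_zero _)
       | (simp only [lowerPart, upperPart, Matrix.of_apply, *, lt_irrefl, if_true, if_false,
            LT.lt.ne, LT.lt.ne', LT.lt.not_gt, mul_assoc, smul_mul_assoc, mul_smul_comm,
            mul_zero, zero_mul, mul_add, add_mul, mul_sub, sub_mul, smul_add, smul_sub,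
            smul_smul, smul_zero, mul_one, one_mul]
          try module))
  case col_zero | col_zero' | col =>
    intro a b c hab
    have := pos a b hab
    rcases lt_trichotomy a c with hac | hac | hac <;>
    rcases lt_trichotomy b c with hbc | hbc | hbc
    all_goals first
    | (exfalso; order)
    | (rcases a.zero_le.eq_or_lt with ha | ha <;> subst_vars <;> first
       | exact absurd ‹_ < (0 : Fin (r + 1))› (Fin.not_lt_zero _)
       | (simp only [lowerPart, upperPart, Matrix.of_apply, *, lt_irrefl, if_true, if_false,
            LT.lt.ne, LT.lt.ne', LT.lt.not_gt, mul_assoc, smul_mul_assoc, mul_smul_comm,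
            mul_zero, zero_mul, mul_add, add_mul, mul_sub, sub_mul, smul_add, smul_sub,
            smul_smul, smul_zero, mul_one, one_mul]
          try module))
  all_goals
    intro a b c d hab hcd
    have := pos a b hab
    have := pos c d hcd
    clear pos
    rcases lt_trichotomy a c with hac | hac | hac <;>
    rcases lt_trichotomy a d with had | had | had <;> try (exfalso; order)
    all_goals rcases lt_trichotomy b c with hbc | hbc | hbc <;> try (exfalso; order)
    all_goals rcases lt_trichotomy b d with hbd | hbd | hbd <;> first
    | (exfalso; order)
    | (rcases a.zero_le.eq_or_lt with ha | ha <;> subst_vars <;> first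
       | exact absurd ‹_ < (0 : Fin (r + 1))› (Fin.not_lt_zero _)
       | (simp only [lowerPart, upperPart, Matrix.of_apply, *, lt_irrefl, if_true, if_false,
            LT.lt.ne, LT.lt.ne', LT.lt.not_gt, mul_assoc, smul_mul_assoc, mul_smul_comm,
            mul_zero, zero_mul, mul_add, add_mul, mul_sub, sub_mul, smul_add, smul_sub,
            smul_smul, smul_zero, mul_one, one_mul]
          try module))

end IsOrderedFamily
end Triangular
/-! ### The L-matrix of a family of bosons -/

section LMatrix

variable {K : Type*} [Field K] {A : Type*} [Ring A] [Algebra K A] {r : ℕ}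

theorem commute_kTail {k : Fin r → A} {a : A} {i : Fin (r + 1)}
    (h : ∀ l : Fin r, i < l.succ → Commute a (k l)) : Commute a (kTail k i) := by
  refine Commute.list_prod_right _ _ fun x hx => ?_
  obtain ⟨l, hl, rfl⟩ := List.mem_map.1 hx
  exact h l (by simpa using hl)

/-- Moving `a` through a tail that contains the factor `k j`, the only one with which `a` does not
commute, costs one power of `t`. -/
theorem mul_kTail_eq_smul {k : Fin r → A} {t : K} {a : A} {i : Fin (r + 1)} {j : Fin r}
    (hij : i < j.succ) (h : ∀ l, l ≠ j → Commute a (k l)) (hj : a * k j = t • (k j * a)) :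
    a * kTail k i = t • (kTail k i * a) := by
  have key : ∀ s : List (Fin r), s.Nodup →
      a * (s.map k).prod = (if j ∈ s then t else 1) • ((s.map k).prod * a) := by
    intro s hs
    induction s with
    | nil => simp
    | cons l s ih =>
      obtain ⟨hls, hs⟩ := List.nodup_cons.1 hs
      rw [List.map_cons, List.prod_cons, ← mul_assoc]
      by_cases hl : l = j
      · subst hl
        have := ih hs
        rw [if_neg hls, one_smul] at this
        rw [hj, smul_mul_assoc, mul_assoc, this]
        simp [mul_assoc]
      · rw [(h l hl).eq, mul_assoc, ih hs, mul_smul_comm]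
        simp [mul_assoc, Ne.symm hl]
  have := key ((List.finRange r).filter fun l => i < l.succ) ((List.nodup_finRange r).filter _)
  simpa [kTail, hij] using this

/-- The mirror image of `mul_kTail_eq_smul`. -/
theorem kTail_mul_eq_smul {k : Fin r → A} {t : K} {a : A} {i : Fin (r + 1)} {j : Fin r}
    (hij : i < j.succ) (h : ∀ l, l ≠ j → Commute a (k l)) (hj : k j * a = t • (a * k j)) :
    kTail k i * a = t • (a * kTail k i) := by
  have key : ∀ s : List (Fin r), s.Nodup →
      (s.map k).prod * a = (if j ∈ s then t else 1) • (a * (s.map k).prod) := by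
    intro s hs
    induction s with
    | nil => simp
    | cons l s ih =>
      obtain ⟨hls, hs⟩ := List.nodup_cons.1 hs
      rw [List.map_cons, List.prod_cons, mul_assoc, ih hs, mul_smul_comm, ← mul_assoc]
      by_cases hl : l = j
      · subst hl
        rw [if_neg hls, hj]
        simp [mul_assoc]
      · rw [← (h l hl).eq]
        simp [mul_assoc, Ne.symm hl]
  have := key ((List.finRange r).filter fun l => i < l.succ) ((List.nodup_finRange r).filter _)
  simpa [kTail, hij] using this

/-- The annihilators `1, φ_1, …, φ_r`, with `1` at the index `0`. -/
def annihilators (φ : Fin r → A) : Fin (r + 1) → A := Fin.cons 1 φ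

/-- The creators `k_{i+1} ⋯ k_r φ†_i`. The value `0` at the index `0` is a convention: no entry of the
L-matrix involves it. -/
def dressedCreators (φd k : Fin r → A) : Fin (r + 1) → A :=
  Fin.cons 0 fun i => kTail k i.succ * φd i

/-- The diagonal of the coefficient of `x`: `-u k_1 ⋯ k_r` at `0` and `k_{i+1} ⋯ k_r` at `i ≥ 1`. -/
def diagonalTails (u : K) (k : Fin r → A) : Fin (r + 1) → A :=
  Fin.cons (-u • kTail k 0) fun i => kTail k i.succ

namespace IsTBosonFamily

variable {t : K} {φ φd k : Fin r → A} (h : IsTBosonFamily t φ φd k)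
include h

theorem commute_k_k (i j : Fin r) : Commute (k i) (k j) := by
  rcases eq_or_ne i j with rfl | hij
  · exact Commute.refl _
  · exact h.comm_k_k i j hij

theorem commute_kTail_kTail (i j : Fin (r + 1)) : Commute (kTail k i) (kTail k j) :=
  commute_kTail fun l _ => (commute_kTail fun l' _ => h.commute_k_k l l').symm

theorem commute_phi_kTail {i : Fin (r + 1)} {j : Fin r} (hij : j.succ ≤ i) :
    Commute (φ j) (kTail k i) :=
  commute_kTail fun l hl => h.comm_phi_k j l (by rintro rfl; exact absurd hl hij.not_gt)

theorem commute_phid_kTail {i : Fin (r + 1)} {j : Fin r} (hij : j.succ ≤ i) :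
    Commute (φd j) (kTail k i) :=
  commute_kTail fun l hl => h.comm_phid_k j l (by rintro rfl; exact absurd hl hij.not_gt)

theorem phi_kTail {i : Fin (r + 1)} {j : Fin r} (hij : i < j.succ) :
    φ j * kTail k i = t • (kTail k i * φ j) :=
  mul_kTail_eq_smul hij (fun l hl => h.comm_phi_k j l hl.symm) (h.phi_k j)

theorem kTail_phid {i : Fin (r + 1)} {j : Fin r} (hij : i < j.succ) :
    kTail k i * φd j = t • (φd j * kTail k i) :=
  kTail_mul_eq_smul hij (fun l hl => h.comm_phid_k j l hl.symm) (h.phid_k j).symm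

theorem isOrderedFamily (u : K) :
    IsOrderedFamily t (annihilators φ) (dressedCreators φd k) (diagonalTails u k) where
  f_zero := rfl
  f_f i j := by
    cases i using Fin.cases <;> cases j using Fin.cases <;> simp [annihilators]
    rename_i i j
    rcases eq_or_ne i j with rfl | hij
    · rfl
    · exact h.comm_phi_phi i j hij
  p_p i j hij := by
    cases i using Fin.cases <;> cases j using Fin.cases <;> simp [dressedCreators]
    rename_i i j
    have e1 := (h.commute_phid_kTail hij.le).eq
    have e2 := h.kTail_phid hij
    have e3 := h.comm_phid_phid i j (by rintro rfl; simp at hij)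
    have e4 := (h.commute_kTail_kTail i.succ j.succ).eq
    rw [mul_assoc, ← mul_assoc (φd i), e1, mul_assoc, ← mul_assoc, e4, e3.eq, mul_assoc,
      ← mul_assoc (kTail k i.succ), e2, mul_assoc (kTail k j.succ), ← mul_assoc (φd j)]
    simp
  Q_Q i j := by
    cases i using Fin.cases <;> cases j using Fin.cases <;>
      simp [diagonalTails, (h.commute_kTail_kTail _ _).eq]
  f_p_lt i j hij := by
    cases i using Fin.cases <;> cases j using Fin.cases <;> simp [annihilators, dressedCreators]
    rename_i i j
    have e1 := (h.commute_phi_kTail hij.le).eq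
    have e3 := h.comm_phi_phid i j (by rintro rfl; simp at hij)
    rw [← mul_assoc, e1, mul_assoc, e3.eq, mul_assoc]
  f_p_gt i j hij := by
    cases i using Fin.cases <;> cases j using Fin.cases <;> simp [annihilators, dressedCreators]
    · simp at hij
    rename_i i j
    have e1 := h.phi_kTail hij
    have e3 := h.comm_phi_phid j i (by rintro rfl; simp at hij)
    rw [← mul_assoc, e1, smul_mul_assoc, mul_assoc, e3.eq, mul_assoc]
  f_p_self i hi := by
    cases i using Fin.cases
    · simp at hi
    rename_i i
    simp only [annihilators, dressedCreators, diagonalTails, Fin.cons_succ]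
    rw [← mul_assoc, (h.commute_phi_kTail le_rfl).eq, mul_assoc, mul_assoc,
      sub_eq_iff_eq_add.1 (h.phi_phid i), mul_add, mul_smul_comm, Algebra.algebraMap_eq_smul_one,
      mul_smul_comm, mul_one]
  f_Q_self i := by
    cases i using Fin.cases <;> simp [annihilators, diagonalTails]
    exact h.commute_phi_kTail le_rfl
  f_Q_lt i j hij := by
    cases i using Fin.cases <;> cases j using Fin.cases <;> simp [annihilators, diagonalTails]
    · simp at hij
    · exact h.commute_phi_kTail hij.le
  f_Q_gt i j hij := by
    cases i using Fin.cases <;> cases j using Fin.cases <;> simp [annihilators, diagonalTails]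
    · simp at hij
    · rw [h.phi_kTail (Fin.succ_pos _), smul_comm]
    · simp at hij
    · exact h.phi_kTail hij
  Q_p_self i := by
    cases i using Fin.cases <;> simp [dressedCreators, diagonalTails]
    rw [mul_assoc, (h.commute_phid_kTail le_rfl).eq]
  Q_p_gt i j hij := by
    cases i using Fin.cases <;> cases j using Fin.cases <;> simp [dressedCreators, diagonalTails]
    · simp at hij
    rename_i i j
    rw [mul_assoc, (h.commute_phid_kTail hij.le).eq, ← mul_assoc, ← mul_assoc,
      (h.commute_kTail_kTail _ _).eq]
  Q_p_lt i j hij := by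
    cases i using Fin.cases <;> cases j using Fin.cases <;> simp [dressedCreators, diagonalTails]
    · rename_i j
      rw [← mul_assoc, (h.commute_kTail_kTail _ _).eq, mul_assoc, h.kTail_phid (Fin.succ_pos _),
        mul_smul_comm, mul_assoc, smul_comm]
    · rename_i i j
      rw [← mul_assoc, (h.commute_kTail_kTail _ _).eq, mul_assoc, h.kTail_phid hij,
        mul_smul_comm, mul_assoc]

theorem LMatrix_eq (u v x : K) :
    LMatrix u v φ φd k x =
      x • lowerPart (annihilators φ) (dressedCreators φd k) (diagonalTails u k) +
        upperPart v (annihilators φ) (dressedCreators φd k) (diagonalTails u k) := by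
  ext i j
  cases i using Fin.cases with
  | zero =>
    cases j using Fin.cases with
    | zero =>
      simp [LMatrix, lowerPart, upperPart, diagonalTails]
      module
    | succ j =>
      simp [LMatrix, lowerPart, upperPart, diagonalTails, annihilators, (Fin.succ_ne_zero j).symm]
      rw [smul_smul, mul_comm v u, sub_eq_add_neg]
  | succ i =>
    cases j using Fin.cases with
    | zero =>
      simp [LMatrix, lowerPart, upperPart, dressedCreators, annihilators]
    | succ j =>
      rcases lt_trichotomy i j with hij | rfl | hij
      · simp [LMatrix, lowerPart, upperPart, dressedCreators, annihilators, hij, hij.ne,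
          hij.not_gt]
      · have e := (commute_kTail (i := i.succ) fun l _ => h.commute_k_k i l).eq
        simp [LMatrix, lowerPart, upperPart, dressedCreators, annihilators, diagonalTails,
          mul_assoc, h.phid_phi, sub_mul, mul_sub, e, ← Algebra.smul_def]
        rw [sub_eq_add_neg]
      · simp [LMatrix, lowerPart, upperPart, dressedCreators, annihilators, hij, hij.ne',
          hij.not_gt]

theorem yangBaxterAlgebra_LMatrix (u v : K) : YangBaxterAlgebra r t (LMatrix u v φ φd k) := by
  have hf := h.isOrderedFamily u
  rw [funext (h.LMatrix_eq u v)]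
  exact yangBaxterAlgebra_of_quadratic hf.isQuadratic_lowerPart (hf.isQuadratic_upperPart v)
    (hf.isMixedQuadratic v)

end IsTBosonFamily

end LMatrix

/-! ### The Fock representation -/

section Fock

variable {K : Type*} [Field K] {r : ℕ}

theorem fockPhi_ket (t : K) (i : Fin r) (m : Fin r → ℕ) :
    fockPhi t i (ket K m) = (1 - t ^ m i) • ket K (Function.update m i (m i - 1)) := by
  simp [fockPhi, ket]

theorem fockPhiDag_ket (i : Fin r) (m : Fin r → ℕ) :
    fockPhiDag K i (ket K m) = ket K (Function.update m i (m i + 1)) := by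
  simp [fockPhiDag, ket]

theorem fockK_ket (t : K) (i : Fin r) (m : Fin r → ℕ) :
    fockK t i (ket K m) = t ^ m i • ket K m := by
  simp [fockK, ket]

theorem fockEnd_ext {a b : Module.End K (FockSpace K r)}
    (h : ∀ m, a (ket K m) = b (ket K m)) : a = b :=
  Finsupp.lhom_ext' fun m => LinearMap.ext_ring (h m)

theorem isTBosonFamily_fock (t : K) :
    IsTBosonFamily t (fockPhi t : Fin r → Module.End K (FockSpace K r)) (fockPhiDag K)
      (fockK t) where
  phi_k i := fockEnd_ext fun m => by
    -- At `m i = 0` the truncated `m i - 1` is harmless: the coefficient `1 - t ^ 0` vanishes.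
    rcases Nat.eq_zero_or_pos (m i) with h0 | h0
    · simp [fockPhi_ket, fockK_ket, h0]
    · obtain ⟨n, hn⟩ := Nat.exists_eq_succ_of_ne_zero h0.ne'
      simp [fockPhi_ket, fockK_ket, hn, smul_smul]
      ring_nf
  phid_k i := fockEnd_ext fun m => by
    simp [fockPhiDag_ket, fockK_ket, smul_smul, pow_succ']
  phi_phid i := fockEnd_ext fun m => by
    rcases Nat.eq_zero_or_pos (m i) with h0 | h0
    · have e : Function.update m i 0 = m := by rw [← h0]; simp
      simp [fockPhi_ket, fockPhiDag_ket, h0, e, Module.algebraMap_end_apply, sub_smul]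
    · obtain ⟨n, hn⟩ := Nat.exists_eq_succ_of_ne_zero h0.ne'
      have e : Function.update m i (n + 1) = m := by rw [← Nat.succ_eq_add_one, ← hn]; simp
      simp [fockPhi_ket, fockPhiDag_ket, hn, e, Module.algebraMap_end_apply]
      module
  phid_phi i := fockEnd_ext fun m => by
    rcases Nat.eq_zero_or_pos (m i) with h0 | h0
    · simp [fockPhi_ket, fockK_ket, h0]
    · obtain ⟨n, hn⟩ := Nat.exists_eq_succ_of_ne_zero h0.ne'
      have e : Function.update m i (n + 1) = m := by rw [← Nat.succ_eq_add_one, ← hn]; simp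
      simp [fockPhi_ket, fockPhiDag_ket, fockK_ket, hn, e]
      module
  comm_phi_phi i j hij := fockEnd_ext fun m => by
    simp [fockPhi_ket, hij, hij.symm, smul_smul, mul_comm, Function.update_comm hij]
  comm_phi_phid i j hij := fockEnd_ext fun m => by
    simp [fockPhi_ket, fockPhiDag_ket, hij, hij.symm, Function.update_comm hij]
  comm_phi_k i j hij := fockEnd_ext fun m => by
    simp [fockPhi_ket, fockK_ket, hij.symm, smul_smul, mul_comm]
  comm_phid_phid i j hij := fockEnd_ext fun m => by
    simp [fockPhiDag_ket, hij, hij.symm, Function.update_comm hij]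
  comm_phid_k i j hij := fockEnd_ext fun m => by
    simp [fockPhiDag_ket, fockK_ket, hij.symm]
  comm_k_k i j hij := fockEnd_ext fun m => by
    simp [fockK_ket, smul_smul, mul_comm]

end Fock

end TBoson

theorem theorem1 {K : Type*} [Field K] (r : ℕ) (t u v : K) :
    (∀ (A : Type*) [Ring A] [Algebra K A] (φ φd k : Fin r → A),
      TBoson.IsTBosonFamily t φ φd k →
        TBoson.YangBaxterAlgebra r t (TBoson.LMatrix u v φ φd k)) ∧
    TBoson.YangBaxterAlgebra r t
      (TBoson.LMatrix u v (TBoson.fockPhi t : Fin r → Module.End K (TBoson.FockSpace K r))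
        (TBoson.fockPhiDag K) (TBoson.fockK t)) :=
  ⟨fun _ _ _ _ _ _ h => h.yangBaxterAlgebra_LMatrix u v,
    (TBoson.isTBosonFamily_fock t).yangBaxterAlgebra_LMatrix u v⟩
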